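/- Let $N\ge 2$, let $\omega\subset\mathbb{R}^{N-1}$ be a bounded domain (nonempty, open, connected) with smooth boundary, and let $\mathcal{C}_\omega=\omega\times(0,\infty)\subset\mathbb{R}^N$ be the half-cylinder spanned by $\omega$. Let $\varphi\in C^2(\overline{\omega})$ with $\varphi>0$ on $\overline\omega$, and put $$\Gamma_\varphi=\{(x',x_N): x'\in\omega,\ x_N=\varphi(x')\},\qquad \Omega_\varphi=\{(x',x_N): x'\in\omega,\ 0<x_N<\varphi(x')\}.$$ Let $\nu=(-\nabla\varphi,1)/\sqrt{1+|\nabla\varphi|^2}$ be the unit normal to $\Gamma_\varphi$ exterior to $\Omega_\varphi$, and let $H_{\Gamma_\varphi}=\frac{1}{N-1}\operatorname{div}_{\Gamma_\varphi}\nu$ be the mean curvature of $\Gamma_\varphi$ with respect to $\nu$, i.e. $H_{\Gamma_\varphi}(x',\varphi(x'))=-\frac1{N-1}\operatorname{div}\bigl(\nabla\varphi/\sqrt{1+|\nabla\varphi|^2}\bigr)(x')$ for $x'\in\omega$. Assume that $\Gamma_\varphi$ meets $\partial\mathcal{C}_\omega$ orthogonally, i.e. at every point of $\overline{\Gamma_\varphi}\cap\partial\mathcal{C}_\omega$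 the normal $\nu$ is orthogonal to the outer unit normal of $\partial\mathcal{C}_\omega$. For a measurable set $E\subseteq\mathcal{C}_\omega$ let $|E|$ be its Lebesgue measure and $$P_{\mathcal{C}_\omega}(E)=\sup\Bigl\{\int_E\operatorname{div}\psi\,dx:\ \psi\in C^1_c(\mathcal{C}_\omega,\mathbb{R}^N),\ \|\psi\|_\infty\le 1\Bigr\}$$ its perimeter relative to $\mathcal{C}_\omega$. Assume that $\Omega_\varphi$ is self-Cheeger relative to $\mathcal{C}_\omega$, i.e. $$\frac{P_{\mathcal{C}_\omega}(\Omega_\varphi)}{|\Omega_\varphi|}=\inf\Bigl\{\frac{P_{\mathcal{C}_\omega}(E)}{|E|}:\ E\subseteq\Omega_\varphi\text{ measurable},\ |E|>0\Bigr\}.$$ Then $P_{\mathcal{C}_\omega}(\Omega_\varphi)<\infty$ and, at every point of $\Gamma_\varphi$, $$H_{\Gamma_\varphi}\le\frac{P_{\mathcal{C}_\omega}(\Omega_\varphi)}{(N-1)\,|\Omega_\varphi|}.$$ -/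

import Mathlib

open MeasureTheory
open scoped ENNReal

namespace RelCheeger

/-- `ℝᵐ` with its Euclidean norm and Lebesgue measure. -/
abbrev Euc (m : ℕ) : Type := EuclideanSpace ℝ (Fin m)

/-! ### Smooth domains and outer normals -/

/-- `ρ` is a smooth local defining function of the set `D` at the boundary point `p`, on the open
neighbourhood `U` of `p`: inside `U`, the set `D` is `{ρ < 0}`, and `∇ρ` does not vanish. -/
structure IsLocalDefiningFunction {m : ℕ} (D : Set (Euc m)) (p : Euc m)
    (U : Set (Euc m)) (ρ : Euc m → ℝ) : Prop where
  isOpen : IsOpen U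
  mem : p ∈ U
  smooth : ContDiffOn ℝ ((⊤ : ℕ∞) : WithTop ℕ∞) ρ U
  zero : ρ p = 0
  gradient_ne_zero : ∀ y ∈ U, gradient ρ y ≠ 0
  inter_eq : D ∩ U = {y ∈ U | ρ y < 0}

/-- A bounded domain (nonempty, open, connected) with `C^∞` boundary. -/
structure IsSmoothBoundedDomain {m : ℕ} (D : Set (Euc m)) : Prop where
  isOpen : IsOpen D
  isConnected : IsConnected D
  isBounded : Bornology.IsBounded D
  smooth_boundary : ∀ p ∈ frontier D, ∃ U ρ, IsLocalDefiningFunction D p U ρ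

/-- `v` is the outer unit normal to `∂D` at `p`, a point near which `∂D` is smooth. -/
def IsOuterUnitNormal {m : ℕ} (D : Set (Euc m)) (p v : Euc m) : Prop :=
  ∃ U ρ, IsLocalDefiningFunction D p U ρ ∧ v = ‖gradient ρ p‖⁻¹ • gradient ρ p

/-! ### Relative perimeter and relative Cheeger sets -/

/-- The divergence `∑ᵢ ∂ᵢ ψᵢ` of a vector field. -/
noncomputable def divergence {m : ℕ} (ψ : Euc m → Euc m) (x : Euc m) : ℝ :=
  ∑ i : Fin m, (fderiv ℝ ψ x (EuclideanSpace.single i 1)) i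

/-- Test fields for the perimeter relative to `C`: `ψ ∈ C¹_c(C, ℝᵐ)` with `‖ψ‖_∞ ≤ 1`. -/
structure IsTestField {m : ℕ} (C : Set (Euc m)) (ψ : Euc m → Euc m) : Prop where
  contDiff : ContDiff ℝ 1 ψ
  hasCompactSupport : HasCompactSupport ψ
  tsupport_subset : tsupport ψ ⊆ C
  norm_le_one : ∀ x, ‖ψ x‖ ≤ 1

/-- The perimeter of (a measurable set) `E` relative to `C`, the supremum of `∫_E div ψ` over the
test fields `ψ`. Test fields are stable under `ψ ↦ -ψ`, so that passing to the positive part of the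
integral (`ENNReal.ofReal`) does not change the supremum. -/
noncomputable def relPerimeter {m : ℕ} (C E : Set (Euc m)) : ℝ≥0∞ :=
  ⨆ (ψ : Euc m → Euc m) (_ : IsTestField C ψ), ENNReal.ofReal (∫ x in E, divergence ψ x)

/-- The competitors for the relative Cheeger constant: the measurable subsets of `Ω` for which the
quotient of perimeter and volume makes sense. -/
structure IsCompetitor {m : ℕ} (Ω E : Set (Euc m)) : Prop where
  measurableSet : MeasurableSet E
  subset : E ⊆ Ω
  volume_ne_zero : volume E ≠ 0
  volume_ne_top : volume E ≠ ∞

/-- The Cheeger constant of `Ω` relative to `C`. -/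
noncomputable def relCheegerConstant {m : ℕ} (C Ω : Set (Euc m)) : ℝ≥0∞ :=
  ⨅ (E : Set (Euc m)) (_ : IsCompetitor Ω E), relPerimeter C E / volume E

/-- `E` is a Cheeger set of `Ω` relative to `C`. -/
def IsRelCheegerSet {m : ℕ} (C Ω E : Set (Euc m)) : Prop :=
  IsCompetitor Ω E ∧ relPerimeter C E / volume E = relCheegerConstant C Ω

/-- `Ω` is self-Cheeger relative to `C`. -/
def IsSelfCheeger {m : ℕ} (C Ω : Set (Euc m)) : Prop :=
  IsRelCheegerSet C Ω Ω

/-! ### Cylinders and graphs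

Points of `ℝ^(n+1)` are written `(x', x_N)` with `N = n + 1`, `x' ∈ ℝⁿ` and `x_N` the last
coordinate. -/

/-- The point `(y, t)` of `ℝ^(n+1)`. -/
noncomputable def pair {n : ℕ} (y : Euc n) (t : ℝ) : Euc (n + 1) :=
  WithLp.toLp 2 (Fin.snoc (α := fun _ => ℝ) (fun i => y i) t)

/-- The projection `(x', x_N) ↦ x'`. -/
noncomputable def base {n : ℕ} (x : Euc (n + 1)) : Euc n :=
  WithLp.toLp 2 (fun i => x i.castSucc)

/-- The last coordinate `(x', x_N) ↦ x_N`. -/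
def height {n : ℕ} (x : Euc (n + 1)) : ℝ := x (Fin.last n)

/-- The half-cylinder `ω × (0, ∞)`. -/
def halfCylinder {n : ℕ} (ω : Set (Euc n)) : Set (Euc (n + 1)) :=
  {x | base x ∈ ω ∧ 0 < height x}

/-- The cartesian graph `Γ_φ` of `φ` over `ω`. -/
def graph {n : ℕ} (ω : Set (Euc n)) (φ : Euc n → ℝ) : Set (Euc (n + 1)) :=
  {x | base x ∈ ω ∧ height x = φ (base x)}

/-- The domain `Ω_φ`, the part of the half-cylinder below the graph of `φ`. -/
def subgraph {n : ℕ} (ω : Set (Euc n)) (φ : Euc n → ℝ) : Set (Euc (n + 1)) :=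
  {x ∈ halfCylinder ω | height x < φ (base x)}

/-- The exterior unit normal `(-∇φ(x'), 1) / √(1 + |∇φ(x')|²)` of `Ω_φ` along the closure of
`Γ_φ`, extended independently of `x_N`. The gradient is taken within the closure of `ω`, so that it
is also meaningful on `∂ω`. -/
noncomputable def graphNormal {n : ℕ} (ω : Set (Euc n)) (φ : Euc n → ℝ) (x : Euc (n + 1)) :
    Euc (n + 1) :=
  (Real.sqrt (1 + ‖gradientWithin φ (closure ω) (base x)‖ ^ 2))⁻¹ •
    pair (-gradientWithin φ (closure ω) (base x)) 1

/-- The graph of `φ` meets the boundary of the cylinder orthogonally: the two normals are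
orthogonal at all common points. -/
def MeetsOrthogonally {n : ℕ} (ω : Set (Euc n)) (φ : Euc n → ℝ) : Prop :=
  ∀ x ∈ closure (graph ω φ) ∩ frontier (halfCylinder ω), ∀ v, IsOuterUnitNormal (halfCylinder ω) x v →
    inner ℝ (graphNormal ω φ x) v = 0

/-- The mean curvature at `x`, with respect to the unit normal `ν` (extended to a neighbourhood of
`x`), of a hypersurface of `ℝ^(n+1)`: the tangential divergence of `ν`, that is, the trace of the
derivative of `ν` on the orthogonal complement of `ν x`, divided by the dimension `n`.
It is `1 / r` for a sphere of radius `r` and its outer normal. -/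
noncomputable def meanCurvature {n : ℕ} (ν : Euc (n + 1) → Euc (n + 1)) (x : Euc (n + 1)) : ℝ :=
  (divergence ν x - inner ℝ (fderiv ℝ ν x (ν x)) (ν x)) / n

end RelCheeger

open RelCheeger

/-!
By the divergence theorem and Cauchy–Schwarz, the perimeter of the subgraph of a `C¹` function `φ`
relative to the half-cylinder is at most the area `∫ √(1 + |∇φ|²)` of its graph; for `φ` of class
`C²`, compactly supported cut-offs of the unit normal are test fields, and they show equality.
For `η ≥ 0` compactly supported in `ω` and small `ε > 0`, the subgraph of `φ - ε η` competes with
`Ω_φ`. At `ε = 0` the volume decreases at rate `∫ η` and the area at rate `-∫ ⟨∇η, V⟩`, where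
`V = -∇φ / √(1 + |∇φ|²)` is the horizontal part of the normal, so minimality of the Cheeger
quotient `h` of `Ω_φ` gives `-∫ ⟨∇η, V⟩ ≤ h ∫ η`. Integrating by parts, `div V ≤ h`, and `div V` is
`n` times the mean curvature of the graph.
-/

namespace RelCheeger

open Set Filter Function Topology Manifold

/-! ### Splitting off the last coordinate -/

section Coordinates

variable {n : ℕ}

@[simp]
theorem pair_castSucc (y : Euc n) (t : ℝ) (i : Fin n) : pair y t i.castSucc = y i := by
  simp [pair]

@[simp]
theorem pair_last (y : Euc n) (t : ℝ) : pair y t (Fin.last n) = t := by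
  simp [pair]

@[simp]
theorem base_apply (x : Euc (n + 1)) (i : Fin n) : base x i = x i.castSucc := rfl

@[simp]
theorem base_pair (y : Euc n) (t : ℝ) : base (pair y t) = y := by
  ext i; simp

@[simp]
theorem height_pair (y : Euc n) (t : ℝ) : height (pair y t) = t := by
  simp [height]

theorem ext_base_height {x z : Euc (n + 1)} (hb : base x = base z) (hh : height x = height z) :
    x = z := by
  ext i
  refine Fin.lastCases hh (fun j => ?_) i
  simpa using congrArg (· j) hb

/-- The linear isomorphism `ℝⁿ × ℝ ≃ ℝ^(n+1)` that underlies `pair`, `base` and `height`; it gives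
access to their regularity and derivatives. -/
noncomputable def pairL (n : ℕ) : (Euc n × ℝ) ≃L[ℝ] Euc (n + 1) :=
  LinearEquiv.toContinuousLinearEquiv
    { toFun := fun p => pair p.1 p.2
      invFun := fun x => (base x, height x)
      map_add' := fun _ _ => ext_base_height (by ext; simp) (by simp [height])
      map_smul' := fun _ _ => ext_base_height (by ext; simp) (by simp [height])
      left_inv := fun p => by simp
      right_inv := fun x => ext_base_height (by simp) (by simp) }

@[simp]
theorem pairL_apply (p : Euc n × ℝ) : pairL n p = pair p.1 p.2 := rfl

/-- The projection `base` as a continuous linear map. -/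
noncomputable def baseL (n : ℕ) : Euc (n + 1) →L[ℝ] Euc n :=
  ContinuousLinearMap.fst ℝ _ _ ∘L (pairL n).symm.toContinuousLinearMap

theorem coe_baseL : ⇑(baseL n) = base := rfl

@[fun_prop]
theorem contDiff_pair {k : WithTop ℕ∞} : ContDiff ℝ k (fun p : Euc n × ℝ => pair p.1 p.2) :=
  (pairL n).contDiff

@[fun_prop]
theorem contDiff_base {k : WithTop ℕ∞} : ContDiff ℝ k (base : Euc (n + 1) → Euc n) :=
  (baseL n).contDiff

@[fun_prop]
theorem continuous_pair : Continuous (fun p : Euc n × ℝ => pair p.1 p.2) :=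
  (pairL n).continuous

@[fun_prop]
theorem continuous_base : Continuous (base : Euc (n + 1) → Euc n) :=
  (baseL n).continuous

@[fun_prop]
theorem continuous_height : Continuous (height : Euc (n + 1) → ℝ) := by
  unfold height; fun_prop

theorem pair_zero_one : pair (0 : Euc n) 1 = EuclideanSpace.single (Fin.last n) 1 :=
  ext_base_height (by ext; simp) (by simp [height])

theorem pair_single_zero (i : Fin n) :
    pair (EuclideanSpace.single i 1) 0 = EuclideanSpace.single i.castSucc (1 : ℝ) :=
  ext_base_height (by ext; simp) (by simp [height])

theorem pair_eq_add_smul (v : Euc n) (a : ℝ) : pair v a = pair v 0 + a • pair 0 1 :=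
  ext_base_height (by ext; simp) (by simp [height])

theorem norm_sq_eq_base_height (x : Euc (n + 1)) : ‖x‖ ^ 2 = ‖base x‖ ^ 2 + height x ^ 2 := by
  simp [EuclideanSpace.norm_sq_eq, Fin.sum_univ_castSucc, height]

theorem measurePreserving_pair (n : ℕ) :
    MeasurePreserving (fun p : Euc n × ℝ => pair p.1 p.2) := by
  have hinsert := (volume_preserving_piFinSuccAbove (fun _ : Fin (n + 1) => ℝ) (Fin.last n)).symm
  have hofLp : MeasurePreserving (Prod.map id WithLp.ofLp : ℝ × Euc n → ℝ × (Fin n → ℝ)) :=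
    (MeasurePreserving.id volume).prod (PiLp.volume_preserving_ofLp (Fin n))
  have hswap : MeasurePreserving (Prod.swap : Euc n × ℝ → ℝ × Euc n) :=
    Measure.measurePreserving_swap
  convert (PiLp.volume_preserving_toLp (Fin (n + 1))).comp (hinsert.comp (hofLp.comp hswap))
    using 1
  ext p i
  refine Fin.lastCases ?_ (fun j => ?_) i <;>
    simp [MeasurableEquiv.piFinSuccAbove, Fin.insertNthEquiv]

end Coordinates

/-! ### Cutoff functions -/

section Cutoff

variable {E F : Type*} [NormedAddCommGroup E] [NormedSpace ℝ E] [NormedAddCommGroup F]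
  [NormedSpace ℝ F]

theorem integrable_of_support_subset_isCompact {X : Type*} [TopologicalSpace X] [T2Space X]
    [MeasurableSpace X] [BorelSpace X] {μ : Measure X} [IsFiniteMeasureOnCompacts μ] {K : Set X}
    (hK : IsCompact K) {f : X → ℝ} (hf : ContinuousOn f K) (hfK : support f ⊆ K) :
    Integrable f μ :=
  (integrableOn_iff_integrable_of_support_subset hfK).1 (hf.integrableOn_compact hK)

theorem contDiff_of_tsupport_subset {k : WithTop ℕ∞} {U : Set E} (hU : IsOpen U) {f : E → F}
    (hf : ContDiffOn ℝ k f U) (hfU : tsupport f ⊆ U) : ContDiff ℝ k f :=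
  (contMDiff_of_tsupport fun _ hx =>
    (hf.contDiffAt (hU.mem_nhds (hfU hx))).contMDiffAt).contDiff

variable [FiniteDimensional ℝ E] {K U : Set E}

theorem exists_contDiff_one_nhdsSet_of_isCompact (k : ℕ∞) (hK : IsCompact K) (hU : IsOpen U)
    (hKU : K ⊆ U) :
    ∃ χ : E → ℝ, ContDiff ℝ k χ ∧ HasCompactSupport χ ∧ tsupport χ ⊆ U ∧
      (∀ᶠ x in 𝓝ˢ K, χ x = 1) ∧ ∀ x, χ x ∈ Icc (0 : ℝ) 1 := by
  obtain ⟨L, hL, hKL, hLU⟩ := exists_compact_between hK hU hKU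
  obtain ⟨χ, hχ1, hχ0, hχI⟩ :=
    exists_contMDiffMap_one_nhds_of_subset_interior 𝓘(ℝ, E) (n := k) hK.isClosed hKL
  have hχL : tsupport χ ⊆ L := closure_minimal (support_subset_iff'.2 hχ0) hL.isClosed
  exact ⟨χ, χ.contMDiff.contDiff, hL.of_isClosed_subset (isClosed_tsupport _) hχL,
    hχL.trans hLU, hχ1, hχI⟩

theorem exists_contDiff_eventuallyEq_nhdsSet {k : ℕ∞} {f : E → F} (hU : IsOpen U)
    (hf : ContDiffOn ℝ k f U) (hK : IsCompact K) (hKU : K ⊆ U) :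
    ∃ g : E → F, ContDiff ℝ k g ∧ g =ᶠ[𝓝ˢ K] f := by
  obtain ⟨χ, hχ, -, hχU, hχ1, -⟩ := exists_contDiff_one_nhdsSet_of_isCompact k hK hU hKU
  refine ⟨fun x => χ x • f x, contDiff_of_tsupport_subset hU (hχ.contDiffOn.smul hf)
    ((tsupport_smul_subset_left χ f).trans hχU), ?_⟩
  filter_upwards [hχ1] with x hx
  rw [hx, one_smul]

theorem nonneg_of_forall_integral_mul_nonneg [MeasurableSpace E] [BorelSpace E]
    {μ : Measure E} [μ.IsOpenPosMeasure] [IsFiniteMeasureOnCompacts μ] {f : E → ℝ}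
    (hU : IsOpen U) (hf : ContinuousOn f U) (k : ℕ∞)
    (h : ∀ η : E → ℝ, ContDiff ℝ k η → HasCompactSupport η → tsupport η ⊆ U → 0 ≤ η →
      0 ≤ ∫ x, η x * f x ∂μ) {x : E} (hx : x ∈ U) : 0 ≤ f x := by
  by_contra! hneg
  have hV : IsOpen (U ∩ f ⁻¹' Iio 0) := hf.isOpen_inter_preimage hU isOpen_Iio
  obtain ⟨η, hηV, hηs, hη, hηI, hηx⟩ :=
    exists_contDiff_tsupport_subset (n := k) (hV.mem_nhds ⟨hx, hneg⟩)
  have hη0 : 0 ≤ η := fun y => (hηI (mem_range_self y)).1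
  have hcont : Continuous fun y => -(η y * f y) :=
    (contDiff_zero.1 <| contDiff_of_tsupport_subset hU
      (contDiffOn_zero.2 (hη.continuous.continuousOn.mul hf))
      ((tsupport_mul_subset_left (f := η)).trans (hηV.trans inter_subset_left))).neg
  have hnonneg : 0 ≤ fun y => -(η y * f y) := fun y => by
    by_cases hy : y ∈ tsupport η
    · exact neg_nonneg.2 (mul_nonpos_of_nonneg_of_nonpos (hη0 y) (le_of_lt (hηV hy).2))
    · simp [image_eq_zero_of_notMem_tsupport hy]
  have hpos : 0 < ∫ y, -(η y * f y) ∂μ :=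
    hcont.integral_pos_of_hasCompactSupport_nonneg_nonzero hηs.mul_right.neg hnonneg
      (x := x) (by simpa [hηx] using hneg.ne)
  rw [integral_neg, neg_pos] at hpos
  exact hpos.not_ge (h η hη hηs (hηV.trans inter_subset_left) hη0)

theorem eventually_forall_mul_lt {X : Type*} [TopologicalSpace X] {η φ : X → ℝ} {s : Set X}
    (hη : ContinuousOn η s) (hηs : HasCompactSupport η) (hηsub : tsupport η ⊆ s)
    (hφ : ContinuousOn φ s) (hφpos : ∀ x ∈ s, 0 < φ x) :
    ∀ᶠ ε in 𝓝 (0 : ℝ), ∀ x ∈ s, ε * η x < φ x := by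
  have hquot : ContinuousOn (fun x => η x / φ x) (tsupport η) :=
    (hη.div hφ fun x hx => (hφpos x hx).ne').mono hηsub
  obtain ⟨C, hC⟩ := IsCompact.exists_bound_of_continuousOn hηs hquot
  have hsmall : ∀ᶠ ε in 𝓝 (0 : ℝ), |ε| * C < 1 :=
    (by fun_prop : Continuous fun ε : ℝ => |ε| * C).continuousAt.eventually_lt_const (by simp)
  filter_upwards [hsmall] with ε hε x hx
  by_cases hxs : x ∈ tsupport η
  · have hlt : ε * (η x / φ x) < 1 := calc
      ε * (η x / φ x) ≤ |ε| * |η x / φ x| := abs_mul ε _ ▸ le_abs_self _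
      _ ≤ |ε| * C := by gcongr; exact hC x hxs
      _ < 1 := hε
    rwa [← mul_div_assoc, div_lt_one (hφpos x hx)] at hlt
  · simpa [image_eq_zero_of_notMem_tsupport hxs] using hφpos x hx

end Cutoff

/-! ### The divergence theorem under a graph -/

section HalfSpace

variable {E : Type*} [NormedAddCommGroup E] [NormedSpace ℝ E] [MeasurableSpace E] [BorelSpace E]

theorem integrable_fderiv_apply {μ : Measure E} [IsFiniteMeasureOnCompacts μ] {f : E → ℝ}
    (hf : ContDiff ℝ 1 f) (hs : HasCompactSupport f) (v : E) :
    Integrable (fun x => fderiv ℝ f x v) μ :=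
  ((hf.continuous_fderiv one_ne_zero).clm_apply
    continuous_const).integrable_of_hasCompactSupport (hs.fderiv_apply ℝ v)

variable [FiniteDimensional ℝ E] {μ : Measure E}

theorem integral_fderiv_eq_zero [μ.IsAddHaarMeasure] {f : E → ℝ} (hf : ContDiff ℝ 1 f)
    (hs : HasCompactSupport f) (v : E) : ∫ x, fderiv ℝ f x v ∂μ = 0 := by
  simpa using integral_mul_fderiv_eq_neg_fderiv_mul_of_integrable (μ := μ)
    (f := fun _ => (1 : ℝ)) (g := f) (v := v) (by simp)
    (by simpa using integrable_fderiv_apply hf hs v)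
    (by simpa using hf.continuous.integrable_of_hasCompactSupport hs)
    (fun _ _ => differentiableAt_const 1) (fun x _ => hf.differentiable one_ne_zero x)

variable {f : E × ℝ → ℝ}

theorem setIntegral_halfSpace_fderiv_tangent [μ.IsAddHaarMeasure] (hf : ContDiff ℝ 1 f)
    (hs : HasCompactSupport f) (v : E) :
    ∫ p in univ ×ˢ Iio 0, fderiv ℝ f p (v, 0) ∂(μ.prod volume) = 0 := by
  have hslice (s : ℝ) : ∫ y, fderiv ℝ f (y, s) (v, 0) ∂μ = 0 := by
    have hcs : HasCompactSupport fun y => f (y, s) := hs.comp_isClosedEmbedding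
      (LeftInverse.isClosedEmbedding (fun _ => rfl : LeftInverse Prod.fst (fun y => (y, s)))
        continuous_fst (by fun_prop))
    have hderiv (y : E) : fderiv ℝ (fun y => f (y, s)) y v = fderiv ℝ f (y, s) (v, 0) := by
      have hcomp : HasFDerivAt (fun y => f (y, s)) _ y :=
        (hf.differentiable one_ne_zero (y, s)).hasFDerivAt.comp y (hasFDerivAt_prodMk_left y s)
      rw [hcomp.fderiv]
      simp
    simpa only [hderiv] using integral_fderiv_eq_zero (by fun_prop) hcs v
  have hint : Integrable (fun p => fderiv ℝ f p (v, 0))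
      ((μ.restrict univ).prod (volume.restrict (Iio 0))) := by
    rw [Measure.prod_restrict]
    exact (integrable_fderiv_apply hf hs (v, 0)).integrableOn
  rw [← Measure.prod_restrict, integral_prod_symm _ hint]
  simp [hslice]

theorem setIntegral_halfSpace_mul_fderiv_normal [IsFiniteMeasureOnCompacts μ]
    {c : E → ℝ} (hc : Continuous c) (hf : ContDiff ℝ 1 f) (hs : HasCompactSupport f) :
    ∫ p in univ ×ˢ Iio 0, c p.1 * fderiv ℝ f p (0, 1) ∂(μ.prod volume)
      = ∫ y, c y * f (y, 0) ∂μ := by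
  have hslice (y : E) : ∫ s in Iio 0, fderiv ℝ f (y, s) (0, 1) = f (y, 0) := by
    have hcs : HasCompactSupport fun s => f (y, s) := hs.comp_isClosedEmbedding
      (LeftInverse.isClosedEmbedding (fun _ => rfl : LeftInverse Prod.snd (Prod.mk y))
        continuous_snd (by fun_prop))
    have hderiv (s : ℝ) : deriv (fun s => f (y, s)) s = fderiv ℝ f (y, s) (0, 1) := by
      have hcomp : HasFDerivAt (fun s => f (y, s)) _ s :=
        (hf.differentiable one_ne_zero (y, s)).hasFDerivAt.comp s (hasFDerivAt_prodMk_right y s)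
      rw [← fderiv_apply_one_eq_deriv, hcomp.fderiv]
      simp
    simpa only [hderiv, integral_Iic_eq_integral_Iio]
      using hcs.integral_Iic_deriv_eq (by fun_prop) 0
  have hint : Integrable (fun p => c p.1 * fderiv ℝ f p (0, 1)) (μ.prod volume) :=
    ((hc.comp continuous_fst).mul ((hf.continuous_fderiv one_ne_zero).clm_apply
      continuous_const)).integrable_of_hasCompactSupport (hs.fderiv_apply ℝ (0, 1)).mul_left
  rw [setIntegral_prod _ hint.integrableOn, Measure.restrict_univ]
  simp only [integral_const_mul, hslice]

end HalfSpace

section DivergenceTheorem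

variable {n : ℕ} {g : Euc n → ℝ} {f : Euc (n + 1) → ℝ}

/-- The region below the graph of `g` over all of `ℝⁿ`, not bounded from below. -/
def hypograph (g : Euc n → ℝ) : Set (Euc (n + 1)) :=
  {x | height x < g (base x)}

/-- The vertical shear `(y, s) ↦ (y, s + g y)`, which straightens `hypograph g` to `{s < 0}`. -/
noncomputable def shear (g : Euc n → ℝ) (p : Euc n × ℝ) : Euc (n + 1) :=
  pair p.1 (p.2 + g p.1)

theorem isOpen_hypograph (hg : Continuous g) : IsOpen (hypograph g) :=
  isOpen_lt continuous_height (hg.comp continuous_base)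

theorem contDiff_shear {k : WithTop ℕ∞} (hg : ContDiff ℝ k g) : ContDiff ℝ k (shear g) := by
  unfold shear
  fun_prop

theorem isClosedEmbedding_shear (hg : Continuous g) : IsClosedEmbedding (shear g) := by
  have hinv : LeftInverse (fun x => (base x, height x - g (base x))) (shear g) := fun p => by
    simp [shear]
  refine hinv.isClosedEmbedding (by fun_prop) ?_
  unfold shear
  fun_prop

theorem measurePreserving_shear (hg : Continuous g) : MeasurePreserving (shear g) :=
  (measurePreserving_pair n).comp <| (MeasurePreserving.id volume).skew_product
    (g := fun y s => s + g y) (by fun_prop)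
    (.of_forall fun y => (measurePreserving_add_right volume (g y)).map_eq)

theorem setIntegral_hypograph (hg : Continuous g) (f : Euc (n + 1) → ℝ) :
    ∫ x in hypograph g, f x = ∫ p in univ ×ˢ Iio 0, f (shear g p) := by
  rw [← (measurePreserving_shear hg).setIntegral_preimage_emb
    (isClosedEmbedding_shear hg).measurableEmbedding]
  congr 2
  ext p
  simp [hypograph, shear]

theorem fderiv_comp_shear (hg : Differentiable ℝ g) (hf : Differentiable ℝ f) (p : Euc n × ℝ)
    (v : Euc n) (t : ℝ) :
    fderiv ℝ (f ∘ shear g) p (v, t)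
      = fderiv ℝ f (shear g p) (pair v (t + fderiv ℝ g p.1 v)) := by
  have hshear : HasFDerivAt (shear g) _ p := (pairL n).hasFDerivAt.comp p
    (hasFDerivAt_fst.prodMk (hasFDerivAt_snd.add ((hg p.1).hasFDerivAt.comp p hasFDerivAt_fst)))
  rw [((hf _).hasFDerivAt.comp p hshear).fderiv]
  simp

theorem setIntegral_hypograph_fderiv_tangent (hg : ContDiff ℝ 1 g) (hf : ContDiff ℝ 1 f)
    (hs : HasCompactSupport f) (v : Euc n) :
    ∫ x in hypograph g, fderiv ℝ f x (pair v (fderiv ℝ g (base x) v)) = 0 := by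
  have hhalf := setIntegral_halfSpace_fderiv_tangent (μ := volume) (hf.comp (contDiff_shear hg))
    (hs.comp_isClosedEmbedding (isClosedEmbedding_shear hg.continuous)) v
  rw [setIntegral_hypograph hg.continuous, Measure.volume_eq_prod]
  simpa [fderiv_comp_shear (hg.differentiable one_ne_zero) (hf.differentiable one_ne_zero),
    shear] using hhalf

theorem setIntegral_hypograph_mul_fderiv_vertical {c : Euc n → ℝ} (hc : Continuous c)
    (hg : ContDiff ℝ 1 g) (hf : ContDiff ℝ 1 f) (hs : HasCompactSupport f) :
    ∫ x in hypograph g, c (base x) * fderiv ℝ f x (pair 0 1) = ∫ y, c y * f (pair y (g y)) := by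
  have hhalf := setIntegral_halfSpace_mul_fderiv_normal (μ := volume) hc
    (hf.comp (contDiff_shear hg))
    (hs.comp_isClosedEmbedding (isClosedEmbedding_shear hg.continuous))
  rw [setIntegral_hypograph hg.continuous, Measure.volume_eq_prod]
  simpa [fderiv_comp_shear (hg.differentiable one_ne_zero) (hf.differentiable one_ne_zero),
    shear] using hhalf

theorem setIntegral_hypograph_fderiv_horizontal (hg : ContDiff ℝ 1 g) (hf : ContDiff ℝ 1 f)
    (hs : HasCompactSupport f) (v : Euc n) :
    ∫ x in hypograph g, fderiv ℝ f x (pair v 0) = -∫ y, fderiv ℝ g y v * f (pair y (g y)) := by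
  have hgv : Continuous fun y => fderiv ℝ g y v :=
    (hg.continuous_fderiv one_ne_zero).clm_apply continuous_const
  have hint : Integrable fun x => fderiv ℝ g (base x) v * fderiv ℝ f x (pair 0 1) :=
    ((hgv.comp continuous_base).mul ((hf.continuous_fderiv one_ne_zero).clm_apply
      continuous_const)).integrable_of_hasCompactSupport (hs.fderiv_apply ℝ (pair 0 1)).mul_left
  have htangent := setIntegral_hypograph_fderiv_tangent hg hf hs v
  simp_rw [pair_eq_add_smul v (fderiv ℝ g _ v), map_add, map_smul, smul_eq_mul] at htangent
  rw [integral_add (integrable_fderiv_apply hf hs _).integrableOn hint.integrableOn,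
    setIntegral_hypograph_mul_fderiv_vertical hgv hg hf hs] at htangent
  exact eq_neg_of_add_eq_zero_left htangent

theorem isClosedEmbedding_pair_graph (hg : Continuous g) :
    IsClosedEmbedding fun y => pair y (g y) :=
  LeftInverse.isClosedEmbedding (fun y => base_pair y (g y)) continuous_base (by fun_prop)

theorem gradient_apply {m : ℕ} (g : Euc m → ℝ) (y : Euc m) (i : Fin m) :
    gradient g y i = fderiv ℝ g y (EuclideanSpace.single i 1) := by
  rw [← inner_gradient_left, EuclideanSpace.inner_single_right]
  simp

theorem divergence_eq_sum {m : ℕ} {ψ : Euc m → Euc m} {x : Euc m} (hψ : DifferentiableAt ℝ ψ x) :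
    divergence ψ x = ∑ i, fderiv ℝ (fun z => ψ z i) x (EuclideanSpace.single i 1) := by
  refine Finset.sum_congr rfl fun i _ => ?_
  have hcoord : HasFDerivAt (fun z => ψ z i) _ x :=
    (EuclideanSpace.proj i : Euc m →L[ℝ] ℝ).hasFDerivAt.comp x hψ.hasFDerivAt
  rw [hcoord.fderiv]
  simp

theorem setIntegral_hypograph_divergence (hg : ContDiff ℝ 1 g) {ψ : Euc (n + 1) → Euc (n + 1)}
    (hψ : ContDiff ℝ 1 ψ) (hs : HasCompactSupport ψ) :
    ∫ x in hypograph g, divergence ψ x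
      = ∫ y, inner ℝ (ψ (pair y (g y))) (pair (-gradient g y) 1) := by
  have hcd (i : Fin (n + 1)) : ContDiff ℝ 1 fun x => ψ x i := by fun_prop
  have hcs (i : Fin (n + 1)) : HasCompactSupport fun x => ψ x i :=
    hs.comp_left (g := fun z : Euc (n + 1) => z i) rfl
  have hgraph := isClosedEmbedding_pair_graph hg.continuous
  have hgcs (i : Fin (n + 1)) : HasCompactSupport fun y => ψ (pair y (g y)) i :=
    (hcs i).comp_isClosedEmbedding hgraph
  have hgc (i : Fin (n + 1)) : Continuous fun y => ψ (pair y (g y)) i :=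
    (hcd i).continuous.comp hgraph.continuous
  have htan (i : Fin n) : Integrable fun y =>
      -(fderiv ℝ g y (EuclideanSpace.single i 1) * ψ (pair y (g y)) i.castSucc) :=
    ((((hg.continuous_fderiv one_ne_zero).clm_apply continuous_const).mul
      (hgc _)).integrable_of_hasCompactSupport (hgcs _).mul_left).neg
  calc ∫ x in hypograph g, divergence ψ x
      = ∑ i, ∫ x in hypograph g, fderiv ℝ (fun z => ψ z i) x (EuclideanSpace.single i 1) := by
        simp_rw [divergence_eq_sum (hψ.differentiable one_ne_zero _)]
        exact integral_finsetSum _ fun i _ =>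
          (integrable_fderiv_apply (hcd i) (hcs i) _).integrableOn
    _ = (∑ i : Fin n, ∫ y, -(fderiv ℝ g y (EuclideanSpace.single i 1)
            * ψ (pair y (g y)) i.castSucc)) + ∫ y, ψ (pair y (g y)) (Fin.last n) := by
        have hvert := setIntegral_hypograph_mul_fderiv_vertical (c := 1) continuous_one hg
          (hcd (Fin.last n)) (hcs _)
        simp only [Pi.one_apply, one_mul] at hvert
        simp_rw [Fin.sum_univ_castSucc, ← pair_single_zero, ← pair_zero_one, hvert,
          setIntegral_hypograph_fderiv_horizontal hg (hcd _) (hcs _), integral_neg]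
    _ = ∫ y, inner ℝ (ψ (pair y (g y))) (pair (-gradient g y) 1) := by
        rw [← integral_finsetSum _ fun i _ => htan i, ← integral_add
          (integrable_finsetSum _ fun i _ => htan i)
          ((hgc _).integrable_of_hasCompactSupport (hgcs _))]
        simp [PiLp.inner_apply, Fin.sum_univ_castSucc, gradient_apply]

end DivergenceTheorem

/-! ### The perimeter of a subgraph -/

section Perimeter

variable {n : ℕ}

/-- The area element `√(1 + |∇φ|²)` of the graph of `φ`. -/
noncomputable def areaElement (φ : Euc n → ℝ) (y : Euc n) : ℝ :=
  √(1 + ‖gradient φ y‖ ^ 2)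

/-- The upward unit normal `(-∇φ, 1) / √(1 + |∇φ|²)` of the graph of `φ`, as a function of the base
point. -/
noncomputable def unitNormal (φ : Euc n → ℝ) (y : Euc n) : Euc (n + 1) :=
  (areaElement φ y)⁻¹ • pair (-gradient φ y) 1

theorem areaElement_pos (φ : Euc n → ℝ) (y : Euc n) : 0 < areaElement φ y :=
  Real.sqrt_pos.2 (by positivity)

theorem norm_pair_neg_gradient (φ : Euc n → ℝ) (y : Euc n) :
    ‖pair (-gradient φ y) 1‖ = areaElement φ y := by
  rw [areaElement, ← Real.sqrt_sq (norm_nonneg _), norm_sq_eq_base_height]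
  simp [add_comm]

theorem norm_unitNormal (φ : Euc n → ℝ) (y : Euc n) : ‖unitNormal φ y‖ = 1 := by
  rw [unitNormal, norm_smul, norm_pair_neg_gradient, norm_inv,
    Real.norm_of_nonneg (areaElement_pos φ y).le, inv_mul_cancel₀ (areaElement_pos φ y).ne']

theorem inner_unitNormal (φ : Euc n → ℝ) (y : Euc n) :
    inner ℝ (unitNormal φ y) (pair (-gradient φ y) 1) = areaElement φ y := by
  rw [unitNormal, real_inner_smul_left, real_inner_self_eq_norm_sq, norm_pair_neg_gradient, sq,
    inv_mul_cancel_left₀ (areaElement_pos φ y).ne']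

variable {ω : Set (Euc n)} {φ : Euc n → ℝ}

theorem contDiffOn_gradient {k l : WithTop ℕ∞} (hω : IsOpen ω) (hφ : ContDiffOn ℝ l φ ω)
    (hkl : k + 1 ≤ l) : ContDiffOn ℝ k (gradient φ) ω :=
  (InnerProductSpace.toDual ℝ (Euc n)).symm.contDiff.comp_contDiffOn
    (hφ.fderiv_of_isOpen hω hkl)

theorem contDiffOn_areaElement {k l : WithTop ℕ∞} (hω : IsOpen ω) (hφ : ContDiffOn ℝ l φ ω)
    (hkl : k + 1 ≤ l) : ContDiffOn ℝ k (areaElement φ) ω :=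
  (contDiffOn_const.add ((contDiffOn_gradient hω hφ hkl).norm_sq ℝ)).sqrt
    fun _ _ => (add_pos_of_pos_of_nonneg one_pos (sq_nonneg _)).ne'

theorem contDiffOn_unitNormal {k l : WithTop ℕ∞} (hω : IsOpen ω) (hφ : ContDiffOn ℝ l φ ω)
    (hkl : k + 1 ≤ l) : ContDiffOn ℝ k (unitNormal φ) ω :=
  ((contDiffOn_areaElement hω hφ hkl).inv fun y _ => (areaElement_pos φ y).ne').smul
    (contDiff_pair.comp_contDiffOn ((contDiffOn_gradient hω hφ hkl).neg.prodMk contDiffOn_const))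

theorem continuousOn_areaElement (hω : IsOpen ω) (hφ : ContDiffOn ℝ 1 φ ω) :
    ContinuousOn (areaElement φ) ω :=
  (contDiffOn_areaElement (k := 0) hω hφ (by simp)).continuousOn

theorem isOpen_halfCylinder (hω : IsOpen ω) : IsOpen (halfCylinder ω) :=
  (hω.preimage continuous_base).inter (isOpen_Ioi.preimage continuous_height)

theorem isOpen_subgraph (hω : IsOpen ω) (hφ : ContinuousOn φ ω) : IsOpen (subgraph ω φ) := by
  have hcont : ContinuousOn (fun x => φ (base x) - height x) (halfCylinder ω) :=
    (hφ.comp continuous_base.continuousOn fun _ hx => hx.1).sub continuous_height.continuousOn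
  convert hcont.isOpen_inter_preimage (isOpen_halfCylinder hω)
    (isOpen_Ioi (a := 0)) using 1
  ext x
  simp [subgraph]

theorem volume_subgraph (hω : MeasurableSet ω) (hφ : AEMeasurable φ (volume.restrict ω)) :
    volume (subgraph ω φ) = ∫⁻ y in ω, ENNReal.ofReal (φ y) := by
  have hpre : (fun p : Euc n × ℝ => pair p.1 p.2) ⁻¹' subgraph ω φ =
      regionBetween (fun _ => 0) φ ω := by
    ext p
    simp [subgraph, halfCylinder, regionBetween, and_assoc]
  rw [← (measurePreserving_pair n).measure_preimage_emb
      (pairL n).toHomeomorph.measurableEmbedding, hpre, Measure.volume_eq_prod,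
    volume_regionBetween_eq_lintegral aemeasurable_const hφ hω]
  simp

theorem divergence_eq_zero_of_notMem_tsupport {m : ℕ} {ψ : Euc m → Euc m} {x : Euc m}
    (hx : x ∉ tsupport ψ) : divergence ψ x = 0 := by
  simp [divergence, fderiv_of_notMem_tsupport (𝕜 := ℝ) hx]

theorem setIntegral_subgraph_divergence (hω : IsOpen ω) (hφ : ContDiffOn ℝ 1 φ ω)
    {ψ : Euc (n + 1) → Euc (n + 1)} (hψ : ContDiff ℝ 1 ψ) (hs : HasCompactSupport ψ)
    (hψω : tsupport ψ ⊆ halfCylinder ω) :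
    ∫ x in subgraph ω φ, divergence ψ x
      = ∫ y in ω, inner ℝ (ψ (pair y (φ y))) (pair (-gradient φ y) 1) := by
  have hbase : base '' tsupport ψ ⊆ ω := image_subset_iff.2 fun x hx => (hψω hx).1
  obtain ⟨g, hg, hgφ⟩ := exists_contDiff_eventuallyEq_nhdsSet (k := 1) hω hφ
    (hs.image continuous_base) hbase
  have hgy (y : Euc n) (hy : y ∈ base '' tsupport ψ) : g =ᶠ[𝓝 y] φ :=
    eventually_nhdsSet_iff_forall.1 hgφ y hy
  calc ∫ x in subgraph ω φ, divergence ψ x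
      = ∫ x in hypograph g, divergence ψ x := by
        rw [← integral_indicator (isOpen_subgraph hω hφ.continuousOn).measurableSet,
          ← integral_indicator (isOpen_hypograph hg.continuous).measurableSet]
        congr 1 with x
        by_cases hx : x ∈ tsupport ψ
        · have hval : g (base x) = φ (base x) := (hgy _ (mem_image_of_mem base hx)).eq_of_nhds
          simp [indicator, subgraph, hypograph, hψω hx, hval]
        · simp [indicator, divergence_eq_zero_of_notMem_tsupport hx]
    _ = ∫ y, inner ℝ (ψ (pair y (g y))) (pair (-gradient g y) 1) :=
        setIntegral_hypograph_divergence hg hψ hs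
    _ = ∫ y in ω, inner ℝ (ψ (pair y (φ y))) (pair (-gradient φ y) 1) := by
        rw [← integral_indicator hω.measurableSet]
        congr 1 with y
        by_cases hy : y ∈ base '' tsupport ψ
        · simp only [indicator, hbase hy, if_true, (hgy y hy).eq_of_nhds, gradient,
            (hgy y hy).fderiv_eq]
        · have hvanish (t : ℝ) : ψ (pair y t) = 0 := image_eq_zero_of_notMem_tsupport fun h =>
            hy ⟨_, h, base_pair y t⟩
          simp [indicator, hvanish]

theorem relPerimeter_subgraph_le (hω : IsOpen ω) (hφ : ContDiffOn ℝ 1 φ ω) :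
    relPerimeter (halfCylinder ω) (subgraph ω φ)
      ≤ ∫⁻ y in ω ∩ φ ⁻¹' Ioi 0, ENNReal.ofReal (areaElement φ y) := by
  refine iSup₂_le fun ψ hψ => ?_
  have hvanish : ∀ y ∈ ω \ (ω ∩ φ ⁻¹' Ioi 0),
      inner ℝ (ψ (pair y (φ y))) (pair (-gradient φ y) 1) = 0 := fun y hy => by
    have hnot : pair y (φ y) ∉ tsupport ψ := fun h =>
      hy.2 ⟨hy.1, by simpa using (hψ.tsupport_subset h).2⟩
    rw [image_eq_zero_of_notMem_tsupport hnot, inner_zero_left]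
  rw [setIntegral_subgraph_divergence hω hφ hψ.contDiff hψ.hasCompactSupport hψ.tsupport_subset,
    setIntegral_eq_of_subset_of_forall_sdiff_eq_zero hω.measurableSet inter_subset_left hvanish]
  refine (Real.ofReal_le_enorm _).trans ((enorm_integral_le_lintegral_enorm _).trans ?_)
  refine lintegral_mono fun y => ?_
  rw [← ofReal_norm, ← norm_pair_neg_gradient]
  exact ENNReal.ofReal_le_ofReal ((norm_inner_le_norm _ _).trans
    (mul_le_of_le_one_left (norm_nonneg _) (hψ.norm_le_one _)))

theorem isTestField_smul_unitNormal (hω : IsOpen ω) (hφ : ContDiffOn ℝ 2 φ ω)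
    {χ : Euc (n + 1) → ℝ} (hχ : ContDiff ℝ 1 χ) (hs : HasCompactSupport χ)
    (hχω : tsupport χ ⊆ halfCylinder ω) (hχI : ∀ x, χ x ∈ Icc (0 : ℝ) 1) :
    IsTestField (halfCylinder ω) fun x => χ x • unitNormal φ (base x) := by
  have hsupp : tsupport (fun x => χ x • unitNormal φ (base x)) ⊆ halfCylinder ω :=
    (tsupport_smul_subset_left χ _).trans hχω
  refine ⟨contDiff_of_tsupport_subset (isOpen_halfCylinder hω) (hχ.contDiffOn.smul ?_) hsupp,
    hs.smul_right, hsupp, fun x => ?_⟩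
  · exact (contDiffOn_unitNormal hω hφ (by norm_num)).comp contDiff_base.contDiffOn
      fun x hx => hx.1
  · rw [norm_smul, norm_unitNormal, mul_one, Real.norm_of_nonneg (hχI x).1]
    exact (hχI x).2

theorem setIntegral_subgraph_divergence_smul_unitNormal (hω : IsOpen ω) (hφ : ContDiffOn ℝ 2 φ ω)
    {χ : Euc (n + 1) → ℝ} (hχ : ContDiff ℝ 1 χ) (hs : HasCompactSupport χ)
    (hχω : tsupport χ ⊆ halfCylinder ω) (hχI : ∀ x, χ x ∈ Icc (0 : ℝ) 1) :
    ∫ x in subgraph ω φ, divergence (fun x => χ x • unitNormal φ (base x)) x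
      = ∫ y in ω, χ (pair y (φ y)) * areaElement φ y := by
  have hψ := isTestField_smul_unitNormal hω hφ hχ hs hχω hχI
  rw [setIntegral_subgraph_divergence hω (hφ.of_le one_le_two) hψ.contDiff hψ.hasCompactSupport
    hψ.tsupport_subset]
  simp only [base_pair, real_inner_smul_left, inner_unitNormal]

theorem integrableOn_mul_of_tsupport_subset_halfCylinder (hω : IsOpen ω) (hφ : ContinuousOn φ ω)
    {χ : Euc (n + 1) → ℝ} (hχ : Continuous χ) (hs : HasCompactSupport χ)
    (hχω : tsupport χ ⊆ halfCylinder ω) {a : Euc n → ℝ} (ha : ContinuousOn a ω) :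
    IntegrableOn (fun y => χ (pair y (φ y)) * a y) ω := by
  have hbase : base '' tsupport χ ⊆ ω := image_subset_iff.2 fun x hx => (hχω hx).1
  have hcont : ContinuousOn (fun y => χ (pair y (φ y)) * a y) ω :=
    (hχ.comp_continuousOn (continuous_pair.comp_continuousOn (continuousOn_id.prodMk hφ))).mul ha
  refine ((hcont.mono hbase).integrableOn_compact
    (hs.image continuous_base)).of_forall_sdiff_eq_zero hω.measurableSet fun y hy => ?_
  rw [image_eq_zero_of_notMem_tsupport fun h => hy.2 ⟨_, h, base_pair _ _⟩, zero_mul]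

theorem setLIntegral_areaElement_le_relPerimeter (hω : IsOpen ω) (hφ : ContDiffOn ℝ 2 φ ω)
    {K : Set (Euc n)} (hK : IsCompact K) (hKω : K ⊆ ω ∩ φ ⁻¹' Ioi 0) :
    ∫⁻ y in K, ENNReal.ofReal (areaElement φ y)
      ≤ relPerimeter (halfCylinder ω) (subgraph ω φ) := by
  have hgraph : ContinuousOn (fun y => pair y (φ y)) K := continuous_pair.comp_continuousOn
    (continuousOn_id.prodMk (hφ.continuousOn.mono (hKω.trans inter_subset_left)))
  have hKcyl : (fun y => pair y (φ y)) '' K ⊆ halfCylinder ω := image_subset_iff.2 fun y hy => by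
    simpa [halfCylinder] using hKω hy
  obtain ⟨χ, hχ, hχs, hχω, hχ1, hχI⟩ := exists_contDiff_one_nhdsSet_of_isCompact 1
    (hK.image_of_continuousOn hgraph) (isOpen_halfCylinder hω) hKcyl
  have hflux := setIntegral_subgraph_divergence_smul_unitNormal hω hφ hχ hχs hχω hχI
  have hint := integrableOn_mul_of_tsupport_subset_halfCylinder hω hφ.continuousOn hχ.continuous
    hχs hχω (continuousOn_areaElement hω (hφ.of_le one_le_two))
  calc ∫⁻ y in K, ENNReal.ofReal (areaElement φ y)
      = ∫⁻ y in K, ENNReal.ofReal (χ (pair y (φ y)) * areaElement φ y) :=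
        setLIntegral_congr_fun hK.measurableSet fun y hy => by
          simp only [hχ1.self_of_nhdsSet _ (mem_image_of_mem _ hy), one_mul]
    _ ≤ ∫⁻ y in ω, ENNReal.ofReal (χ (pair y (φ y)) * areaElement φ y) :=
        lintegral_mono_set (hKω.trans inter_subset_left)
    _ = ENNReal.ofReal (∫ y in ω, χ (pair y (φ y)) * areaElement φ y) :=
        (ofReal_integral_eq_lintegral_ofReal hint (.of_forall fun y =>
          mul_nonneg (hχI _).1 (areaElement_pos φ y).le)).symm
    _ ≤ relPerimeter (halfCylinder ω) (subgraph ω φ) :=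
        hflux ▸ le_iSup₂ (f := fun ψ (_ : IsTestField (halfCylinder ω) ψ) =>
          ENNReal.ofReal (∫ x in subgraph ω φ, divergence ψ x)) _
          (isTestField_smul_unitNormal hω hφ hχ hχs hχω hχI)

theorem isSigmaCompact_of_isOpen {X : Type*} [TopologicalSpace X] [LocallyCompactSpace X]
    [SecondCountableTopology X] {U : Set X} (hU : IsOpen U) : IsSigmaCompact U := by
  have := hU.locallyCompactSpace
  exact isSigmaCompact_iff_sigmaCompactSpace.2 inferInstance

theorem setLIntegral_le_of_forall_isCompact {X : Type*} [TopologicalSpace X] [MeasurableSpace X]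
    {μ : Measure X} {U : Set X} (hU : IsSigmaCompact U) {f : X → ℝ≥0∞} {c : ℝ≥0∞}
    (h : ∀ K ⊆ U, IsCompact K → ∫⁻ x in K, f x ∂μ ≤ c) : ∫⁻ x in U, f x ∂μ ≤ c := by
  obtain ⟨K, hK, rfl⟩ := hU
  rw [← iUnion_accumulate, setLIntegral_iUnion_of_directed _ monotone_accumulate.directed_le]
  exact iSup_le fun k => h _ (accumulate_subset_iUnion k) (isCompact_accumulate hK k)

theorem relPerimeter_subgraph (hω : IsOpen ω) (hφ : ContDiffOn ℝ 2 φ ω) :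
    relPerimeter (halfCylinder ω) (subgraph ω φ)
      = ∫⁻ y in ω ∩ φ ⁻¹' Ioi 0, ENNReal.ofReal (areaElement φ y) :=
  (relPerimeter_subgraph_le hω (hφ.of_le one_le_two)).antisymm <|
    setLIntegral_le_of_forall_isCompact
      (isSigmaCompact_of_isOpen (hφ.continuousOn.isOpen_inter_preimage hω isOpen_Ioi))
      fun _ hKω hK => setLIntegral_areaElement_le_relPerimeter hω hφ hK hKω

end Perimeter

/-! ### The mean curvature of a graph -/

section Curvature

theorem continuousOn_divergence {m : ℕ} {U : Set (Euc m)} (hU : IsOpen U) {V : Euc m → Euc m}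
    (hV : ContDiffOn ℝ 1 V U) : ContinuousOn (divergence V) U :=
  continuousOn_finsetSum _ fun i _ =>
    (EuclideanSpace.proj (𝕜 := ℝ) i).continuous.comp_continuousOn
      ((hV.continuousOn_fderiv_of_isOpen hU le_rfl).clm_apply continuousOn_const)

theorem integral_mul_divergence {m : ℕ} {U : Set (Euc m)} (hU : IsOpen U) {V : Euc m → Euc m}
    (hV : ContDiffOn ℝ 1 V U) {η : Euc m → ℝ} (hη : ContDiff ℝ 1 η) (hs : HasCompactSupport η)
    (hηU : tsupport η ⊆ U) :
    ∫ y, η y * divergence V y = -∫ y, inner ℝ (V y) (gradient η y) := by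
  let e (i : Fin m) : Euc m := EuclideanSpace.single i 1
  have hVi (i : Fin m) : ContDiffOn ℝ 1 (fun y => V y i) U := by fun_prop
  have hVd (i : Fin m) : ContinuousOn (fun y => fderiv ℝ (fun z => V z i) y (e i)) U :=
    ((hVi i).continuousOn_fderiv_of_isOpen hU le_rfl).clm_apply continuousOn_const
  have hηd (i : Fin m) : Continuous fun y => fderiv ℝ η y (e i) :=
    (hη.continuous_fderiv one_ne_zero).clm_apply continuous_const
  have hint (i : Fin m) : Integrable fun y => η y * fderiv ℝ (fun z => V z i) y (e i) :=
    integrable_of_support_subset_isCompact hs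
      (hη.continuous.continuousOn.mul ((hVd i).mono hηU))
      ((support_mul_subset_left _ _).trans (subset_tsupport η))
  have hint' (i : Fin m) : Integrable fun y => fderiv ℝ η y (e i) * V y i :=
    integrable_of_support_subset_isCompact hs
      ((hηd i).continuousOn.mul ((hVi i).continuousOn.mono hηU))
      ((support_mul_subset_left _ _).trans
        ((subset_tsupport _).trans (tsupport_fderiv_apply_subset ℝ (e i))))
  calc ∫ y, η y * divergence V y
      = ∫ y, ∑ i, η y * fderiv ℝ (fun z => V z i) y (e i) := by
        congr 1 with y
        by_cases hy : y ∈ tsupport η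
        · rw [divergence_eq_sum ((hV.differentiableOn one_ne_zero).differentiableAt
            (hU.mem_nhds (hηU hy))), Finset.mul_sum]
        · simp [image_eq_zero_of_notMem_tsupport hy]
    _ = ∑ i, -∫ y, fderiv ℝ η y (e i) * V y i := by
        rw [integral_finsetSum _ fun i _ => hint i]
        refine Finset.sum_congr rfl fun i _ =>
          integral_mul_fderiv_eq_neg_fderiv_mul_of_integrable (hint' i) (hint i) ?_
            (fun y _ => hη.differentiable one_ne_zero y) fun y hy =>
            ((hVi i).differentiableOn one_ne_zero).differentiableAt (hU.mem_nhds (hηU hy))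
        exact integrable_of_support_subset_isCompact hs
          (hη.continuous.continuousOn.mul ((hVi i).continuousOn.mono hηU))
          ((support_mul_subset_left _ _).trans (subset_tsupport η))
    _ = -∫ y, inner ℝ (V y) (gradient η y) := by
        rw [Finset.sum_neg_distrib, ← integral_finsetSum _ fun i _ => hint' i]
        simp only [PiLp.inner_apply, gradient_apply, e, RCLike.inner_apply, conj_trivial]

theorem inner_fderiv_eq_zero_of_norm_eventuallyEq {E F : Type*} [NormedAddCommGroup E]
    [NormedSpace ℝ E] [NormedAddCommGroup F] [InnerProductSpace ℝ F] {ν : E → F} {x : E}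
    (hν : DifferentiableAt ℝ ν x) {c : ℝ} (hc : ∀ᶠ z in 𝓝 x, ‖ν z‖ = c) (v : E) :
    inner ℝ (fderiv ℝ ν x v) (ν x) = 0 := by
  have hconst : (fun z => inner ℝ (ν z) (ν z)) =ᶠ[𝓝 x] fun _ => c ^ 2 := by
    filter_upwards [hc] with z hz
    rw [real_inner_self_eq_norm_sq, hz]
  have hderiv := fderiv_inner_apply ℝ hν hν v
  rw [hconst.fderiv_eq, real_inner_comm, fderiv_fun_const] at hderiv
  exact self_eq_neg.1 (eq_neg_of_add_eq_zero_left hderiv.symm)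

variable {n : ℕ}

theorem divergence_comp_base {N : Euc n → Euc (n + 1)} {x : Euc (n + 1)}
    (hN : DifferentiableAt ℝ N (base x)) :
    divergence (N ∘ base) x = divergence (base ∘ N) (base x) := by
  have hleft : HasFDerivAt (N ∘ base) (fderiv ℝ N (base x) ∘L baseL n) x :=
    hN.hasFDerivAt.comp x (baseL n).hasFDerivAt
  have hright : HasFDerivAt (base ∘ N) (baseL n ∘L fderiv ℝ N (base x)) (base x) :=
    (baseL n).hasFDerivAt.comp (base x) hN.hasFDerivAt
  rw [divergence, divergence, hleft.fderiv, hright.fderiv, Fin.sum_univ_castSucc,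
    ← pair_zero_one]
  simp [← pair_single_zero, coe_baseL]

/-- The horizontal component `-∇φ / √(1 + |∇φ|²)` of the unit normal of the graph of `φ`. -/
noncomputable def horizontalNormal (φ : Euc n → ℝ) : Euc n → Euc n :=
  base ∘ unitNormal φ

variable {ω : Set (Euc n)} {φ : Euc n → ℝ}

theorem horizontalNormal_eq_smul (φ : Euc n → ℝ) (y : Euc n) :
    horizontalNormal φ y = -((areaElement φ y)⁻¹ • gradient φ y) := by
  ext i
  simp [horizontalNormal, unitNormal]

theorem contDiffOn_horizontalNormal {k l : WithTop ℕ∞} (hω : IsOpen ω) (hφ : ContDiffOn ℝ l φ ω)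
    (hkl : k + 1 ≤ l) : ContDiffOn ℝ k (horizontalNormal φ) ω :=
  contDiff_base.comp_contDiffOn (contDiffOn_unitNormal hω hφ hkl)

theorem graphNormal_eq_unitNormal (hω : IsOpen ω) (φ : Euc n → ℝ) {x : Euc (n + 1)}
    (hx : base x ∈ ω) : graphNormal ω φ x = unitNormal φ (base x) := by
  have hgrad : gradientWithin φ (closure ω) (base x) = gradient φ (base x) := by
    rw [gradientWithin, gradient,
      fderivWithin_of_mem_nhds (mem_of_superset (hω.mem_nhds hx) subset_closure)]
  rw [graphNormal, hgrad, unitNormal, areaElement]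

theorem meanCurvature_graphNormal (hω : IsOpen ω) (hφ : ContDiffOn ℝ 2 φ ω) {x : Euc (n + 1)}
    (hx : base x ∈ ω) :
    meanCurvature (graphNormal ω φ) x = divergence (horizontalNormal φ) (base x) / n := by
  have hN : DifferentiableAt ℝ (unitNormal φ) (base x) :=
    ((contDiffOn_unitNormal (k := 1) hω hφ (by norm_num)).differentiableOn
      one_ne_zero).differentiableAt (hω.mem_nhds hx)
  have heq : graphNormal ω φ =ᶠ[𝓝 x] unitNormal φ ∘ base := by
    filter_upwards [(hω.preimage continuous_base).mem_nhds hx] with z hz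
    exact graphNormal_eq_unitNormal hω φ hz
  have hunit := inner_fderiv_eq_zero_of_norm_eventuallyEq
    (hN.comp x (baseL n).differentiableAt) (.of_forall fun z => norm_unitNormal φ (base z))
  rw [meanCurvature, heq.fderiv_eq, heq.eq_of_nhds, hunit, sub_zero, divergence, heq.fderiv_eq]
  congr 1
  exact divergence_comp_base hN

theorem sqrt_one_add_norm_add_sq_le {E : Type*} [NormedAddCommGroup E] [InnerProductSpace ℝ E]
    (p q : E) :
    √(1 + ‖p + q‖ ^ 2) ≤ √(1 + ‖p‖ ^ 2) + (√(1 + ‖p‖ ^ 2))⁻¹ * (inner ℝ p q + ‖q‖ ^ 2 / 2) := by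
  have hA : 0 < √(1 + ‖p‖ ^ 2) := Real.sqrt_pos.2 (by positivity)
  -- AM-GM for the two square roots `a` and `b` gives `b ≤ a + (b² - a²) / (2a)`.
  have hAMGM := two_mul_le_add_sq (√(1 + ‖p‖ ^ 2)) (√(1 + ‖p + q‖ ^ 2))
  rw [Real.sq_sqrt (by positivity), Real.sq_sqrt (by positivity), norm_add_sq_real] at hAMGM
  rw [← mul_le_mul_iff_right₀ hA, mul_add, mul_inv_cancel_left₀ hA.ne', ← sq,
    Real.sq_sqrt (by positivity), norm_add_sq_real]
  linarith

theorem areaElement_sub_const_mul_le {η : Euc n → ℝ} {y : Euc n} (hφ : DifferentiableAt ℝ φ y)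
    (hη : DifferentiableAt ℝ η y) (ε : ℝ) :
    areaElement (fun z => φ z - ε * η z) y
      ≤ areaElement φ y + ε * inner ℝ (horizontalNormal φ y) (gradient η y)
        + ε ^ 2 * ((areaElement φ y)⁻¹ * ‖gradient η y‖ ^ 2 / 2) := by
  have hgrad : gradient (fun z => φ z - ε * η z) y = gradient φ y + (-ε) • gradient η y := by
    rw [gradient, fderiv_fun_sub hφ (hη.const_mul ε), fderiv_const_mul hη, map_sub, map_smul,
      sub_eq_add_neg, neg_smul, gradient, gradient]
  have hbound := sqrt_one_add_norm_add_sq_le (gradient φ y) ((-ε) • gradient η y)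
  rw [areaElement, hgrad]
  refine hbound.trans_eq ?_
  rw [horizontalNormal_eq_smul, inner_neg_left, real_inner_smul_left, real_inner_smul_right,
    norm_smul, mul_pow, Real.norm_eq_abs, sq_abs, ← areaElement]
  ring

end Curvature

/-! ### Self-Cheeger subgraphs -/

section SelfCheeger

namespace IsSelfCheeger

variable {m : ℕ} {C Ω E : Set (Euc m)}

theorem div_volume_le (h : IsSelfCheeger C Ω) (hE : IsCompetitor Ω E) :
    relPerimeter C Ω / volume Ω ≤ relPerimeter C E / volume E :=
  h.2.le.trans (iInf₂_le E hE)

theorem relPerimeter_ne_top (h : IsSelfCheeger C Ω) (hE : IsCompetitor Ω E)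
    (hfin : relPerimeter C E ≠ ∞) : relPerimeter C Ω ≠ ∞ := by
  intro htop
  have hle := h.div_volume_le hE
  rw [htop, ENNReal.top_div_of_ne_top h.1.volume_ne_top, top_le_iff] at hle
  exact ENNReal.div_ne_top hfin hE.volume_ne_zero hle

theorem toReal_div_mul_volume_le (h : IsSelfCheeger C Ω) (hE : IsCompetitor Ω E)
    (hfin : relPerimeter C E ≠ ∞) :
    (relPerimeter C Ω).toReal / (volume Ω).toReal * (volume E).toReal
      ≤ (relPerimeter C E).toReal := by
  have hdiv := ENNReal.toReal_mono (ENNReal.div_ne_top hfin hE.volume_ne_zero)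
    (h.div_volume_le hE)
  rwa [ENNReal.toReal_div, ENNReal.toReal_div,
    le_div_iff₀ (ENNReal.toReal_pos hE.volume_ne_zero hE.volume_ne_top)] at hdiv

end IsSelfCheeger

variable {n : ℕ} {ω : Set (Euc n)} {φ : Euc n → ℝ}

theorem isCompetitor_subgraph (hω : IsOpen ω) {θ : Euc n → ℝ} (hθ : ContinuousOn θ ω)
    (hθφ : ∀ y ∈ ω, θ y ≤ φ y) (hθpos : ∃ y ∈ ω, 0 < θ y) (hvol : volume (subgraph ω φ) ≠ ∞) :
    IsCompetitor (subgraph ω φ) (subgraph ω θ) := by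
  have hopen : IsOpen (subgraph ω θ) := isOpen_subgraph hω hθ
  have hsub : subgraph ω θ ⊆ subgraph ω φ := fun x hx => ⟨hx.1, hx.2.trans_le (hθφ _ hx.1.1)⟩
  obtain ⟨y, hy, hθy⟩ := hθpos
  have hmem : pair y (θ y / 2) ∈ subgraph ω θ := by
    simpa [subgraph, halfCylinder, hy] using hθy
  exact ⟨hopen.measurableSet, hsub, (hopen.measure_pos volume ⟨_, hmem⟩).ne',
    measure_ne_top_of_subset hsub hvol⟩

theorem relPerimeter_subgraph_ne_top (hω : IsOpen ω) (hφ : ContinuousOn φ ω)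
    (hφpos : ∀ y ∈ ω, 0 < φ y) (hself : IsSelfCheeger (halfCylinder ω) (subgraph ω φ)) :
    relPerimeter (halfCylinder ω) (subgraph ω φ) ≠ ∞ := by
  obtain ⟨x, hx⟩ := nonempty_of_measure_ne_zero hself.1.volume_ne_zero
  obtain ⟨η, hηω, hηs, hη, -, hηx⟩ :=
    exists_contDiff_tsupport_subset (n := 1) (hω.mem_nhds hx.1.1)
  obtain ⟨ε, hεφ, hε⟩ := (((eventually_forall_mul_lt hη.continuous.continuousOn hηs hηω hφ
    hφpos).filter_mono nhdsWithin_le_nhds).and self_mem_nhdsWithin :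
      ∀ᶠ ε in 𝓝[>] 0, (∀ y ∈ ω, ε * η y < φ y) ∧ 0 < ε).exists
  have hbump : ContDiff ℝ 1 fun y => ε * η y := contDiff_const.mul hη
  refine hself.relPerimeter_ne_top (isCompetitor_subgraph hω hbump.continuous.continuousOn
    (fun y hy => (hεφ y hy).le) ⟨_, hx.1.1, by simpa [hηx] using hε⟩ hself.1.volume_ne_top) ?_
  have hsupp : ω ∩ (fun y => ε * η y) ⁻¹' Ioi 0 ⊆ tsupport η := fun y hy =>
    subset_tsupport η (right_ne_zero_of_mul (ne_of_gt hy.2))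
  have harea : IntegrableOn (areaElement fun y => ε * η y) (tsupport η) :=
    ((continuousOn_areaElement isOpen_univ hbump.contDiffOn).mono
      (subset_univ _)).integrableOn_compact hηs
  exact ne_top_of_le_ne_top harea.lintegral_lt_top.ne
    ((relPerimeter_subgraph_le hω hbump.contDiffOn).trans (lintegral_mono_set hsupp))

theorem integrableOn_of_volume_subgraph_ne_top (hω : IsOpen ω) (hφ : ContinuousOn φ ω)
    (hφ0 : ∀ y ∈ ω, 0 ≤ φ y) (hvol : volume (subgraph ω φ) ≠ ∞) : IntegrableOn φ ω := by
  have hmeas := hφ.aestronglyMeasurable (μ := volume) hω.measurableSet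
  rw [volume_subgraph hω.measurableSet hmeas.aemeasurable] at hvol
  exact (lintegral_ofReal_ne_top_iff_integrable hmeas
    (ae_restrict_of_forall_mem hω.measurableSet hφ0)).1 hvol

theorem toReal_volume_subgraph (hω : IsOpen ω) (hφ : ContinuousOn φ ω)
    (hφ0 : ∀ y ∈ ω, 0 ≤ φ y) : (volume (subgraph ω φ)).toReal = ∫ y in ω, φ y := by
  have hmeas := hφ.aestronglyMeasurable (μ := volume) hω.measurableSet
  rw [volume_subgraph hω.measurableSet hmeas.aemeasurable,
    integral_eq_lintegral_of_nonneg_ae (ae_restrict_of_forall_mem hω.measurableSet hφ0) hmeas]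

theorem integrableOn_areaElement (hω : IsOpen ω) (hφ : ContDiffOn ℝ 2 φ ω)
    (hφpos : ∀ y ∈ ω, 0 < φ y) (hfin : relPerimeter (halfCylinder ω) (subgraph ω φ) ≠ ∞) :
    IntegrableOn (areaElement φ) ω := by
  rw [relPerimeter_subgraph hω hφ, inter_eq_left.2 (show ω ⊆ φ ⁻¹' Ioi 0 from hφpos)] at hfin
  exact (lintegral_ofReal_ne_top_iff_integrable
    ((continuousOn_areaElement hω (hφ.of_le one_le_two)).aestronglyMeasurable hω.measurableSet)
    (.of_forall fun y => (areaElement_pos φ y).le)).1 hfin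

theorem toReal_relPerimeter_subgraph (hω : IsOpen ω) (hφ : ContDiffOn ℝ 2 φ ω)
    (hφpos : ∀ y ∈ ω, 0 < φ y) :
    (relPerimeter (halfCylinder ω) (subgraph ω φ)).toReal = ∫ y in ω, areaElement φ y := by
  rw [relPerimeter_subgraph hω hφ, inter_eq_left.2 (show ω ⊆ φ ⁻¹' Ioi 0 from hφpos),
    integral_eq_lintegral_of_nonneg_ae (.of_forall fun y => (areaElement_pos φ y).le)
    ((continuousOn_areaElement hω (hφ.of_le one_le_two)).aestronglyMeasurable hω.measurableSet)]

theorem toReal_relPerimeter_subgraph_le (hω : IsOpen ω) {θ G : Euc n → ℝ}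
    (hθ : ContDiffOn ℝ 1 θ ω) (hG : IntegrableOn G ω) (hle : ∀ y ∈ ω, areaElement θ y ≤ G y) :
    relPerimeter (halfCylinder ω) (subgraph ω θ) ≠ ∞ ∧
      (relPerimeter (halfCylinder ω) (subgraph ω θ)).toReal ≤ ∫ y in ω, G y := by
  have hG0 (y : Euc n) (hy : y ∈ ω) : 0 ≤ G y := (areaElement_pos θ y).le.trans (hle y hy)
  have hbound : relPerimeter (halfCylinder ω) (subgraph ω θ)
      ≤ ENNReal.ofReal (∫ y in ω, G y) := by
    rw [ofReal_integral_eq_lintegral_ofReal hG (ae_restrict_of_forall_mem hω.measurableSet hG0)]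
    exact (relPerimeter_subgraph_le hω hθ).trans <|
      (lintegral_mono_set inter_subset_left).trans <|
        setLIntegral_mono' hω.measurableSet fun y hy => ENNReal.ofReal_le_ofReal (hle y hy)
  exact ⟨ne_top_of_le_ne_top ENNReal.ofReal_ne_top hbound,
    ENNReal.toReal_le_of_le_ofReal (setIntegral_nonneg hω.measurableSet hG0) hbound⟩

end SelfCheeger

/-! ### The first variation -/

section FirstVariation

variable {n : ℕ} {ω : Set (Euc n)} {φ η : Euc n → ℝ}

theorem gradient_eq_zero_of_notMem_tsupport {y : Euc n} (hy : y ∉ tsupport η) :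
    gradient η y = 0 := by
  rw [gradient, fderiv_of_notMem_tsupport (𝕜 := ℝ) hy, map_zero]

theorem integrable_inner_horizontalNormal (hω : IsOpen ω) (hφ : ContDiffOn ℝ 1 φ ω)
    (hη : ContDiff ℝ 1 η) (hs : HasCompactSupport η) (hηω : tsupport η ⊆ ω) :
    Integrable fun y => inner ℝ (horizontalNormal φ y) (gradient η y) :=
  integrable_of_support_subset_isCompact hs
    ((((contDiffOn_horizontalNormal (k := 0) hω hφ (by simp)).continuousOn).mono hηω).inner
      ((contDiffOn_gradient (k := 0) isOpen_univ hη.contDiffOn (by simp)).continuousOn.mono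
        (subset_univ _)))
    (support_subset_iff'.2 fun y hy => by
      rw [gradient_eq_zero_of_notMem_tsupport hy, inner_zero_right])

theorem integrable_inv_areaElement_mul (hω : IsOpen ω) (hφ : ContDiffOn ℝ 1 φ ω)
    (hη : ContDiff ℝ 1 η) (hs : HasCompactSupport η) (hηω : tsupport η ⊆ ω) :
    Integrable fun y => (areaElement φ y)⁻¹ * ‖gradient η y‖ ^ 2 / 2 :=
  integrable_of_support_subset_isCompact hs
    ((((continuousOn_areaElement hω hφ).inv₀ fun y _ => (areaElement_pos φ y).ne').mono hηω
      |>.mul (((contDiffOn_gradient (k := 0) isOpen_univ hη.contDiffOn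
        (by simp)).continuousOn.mono (subset_univ _)).norm.pow 2)).div_const 2)
    (support_subset_iff'.2 fun y hy => by simp [gradient_eq_zero_of_notMem_tsupport hy])

theorem toReal_relPerimeter_subgraph_sub_le (hω : IsOpen ω) (hφ : ContDiffOn ℝ 1 φ ω)
    (harea : IntegrableOn (areaElement φ) ω) (hη : ContDiff ℝ 1 η) (hs : HasCompactSupport η)
    (hηω : tsupport η ⊆ ω) (ε : ℝ) :
    relPerimeter (halfCylinder ω) (subgraph ω fun y => φ y - ε * η y) ≠ ∞ ∧
      (relPerimeter (halfCylinder ω) (subgraph ω fun y => φ y - ε * η y)).toReal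
        ≤ (∫ y in ω, areaElement φ y)
          + ε * (∫ y, inner ℝ (horizontalNormal φ y) (gradient η y))
          + ε ^ 2 * ∫ y, (areaElement φ y)⁻¹ * ‖gradient η y‖ ^ 2 / 2 := by
  have hfirst := integrable_inner_horizontalNormal hω hφ hη hs hηω
  have hsecond := integrable_inv_areaElement_mul hω hφ hη hs hηω
  have hlinear := harea.fun_add (hfirst.const_mul ε).integrableOn
  have hgrad (y : Euc n) (hy : y ∉ ω) : gradient η y = 0 :=
    gradient_eq_zero_of_notMem_tsupport fun h => hy (hηω h)
  have hθ : ContDiffOn ℝ 1 (fun y => φ y - ε * η y) ω :=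
    ContDiffOn.sub hφ (contDiffOn_const.mul hη.contDiffOn)
  rw [← setIntegral_eq_integral_of_forall_compl_eq_zero (s := ω)
      (f := fun y => inner ℝ (horizontalNormal φ y) (gradient η y))
      fun y hy => by rw [hgrad y hy, inner_zero_right],
    ← setIntegral_eq_integral_of_forall_compl_eq_zero (s := ω)
      (f := fun y => (areaElement φ y)⁻¹ * ‖gradient η y‖ ^ 2 / 2)
      fun y hy => by simp [hgrad y hy],
    ← integral_const_mul, ← integral_const_mul,
    ← integral_add harea (hfirst.const_mul ε).integrableOn,
    ← integral_add hlinear (hsecond.const_mul (ε ^ 2)).integrableOn]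
  exact toReal_relPerimeter_subgraph_le hω hθ
    (hlinear.fun_add (hsecond.const_mul (ε ^ 2)).integrableOn) fun y hy =>
      areaElement_sub_const_mul_le
        ((hφ.differentiableOn one_ne_zero).differentiableAt (hω.mem_nhds hy))
        (hη.differentiable one_ne_zero y) ε

theorem toReal_volume_subgraph_sub (hω : IsOpen ω) (hφ : ContinuousOn φ ω)
    (hφint : IntegrableOn φ ω) (hη : Continuous η) (hs : HasCompactSupport η)
    (hηω : tsupport η ⊆ ω) {ε : ℝ} (hεη : ∀ y ∈ ω, ε * η y ≤ φ y) :
    (volume (subgraph ω fun y => φ y - ε * η y)).toReal = (∫ y in ω, φ y) - ε * ∫ y, η y := by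
  have hηint : Integrable fun y => ε * η y := (hη.integrable_of_hasCompactSupport hs).const_mul ε
  rw [toReal_volume_subgraph hω (hφ.fun_sub (hη.const_mul ε).continuousOn)
      fun y hy => sub_nonneg.2 (hεη y hy),
    integral_sub hφint hηint.integrableOn, integral_const_mul,
    setIntegral_eq_integral_of_forall_compl_eq_zero fun y hy =>
      image_eq_zero_of_notMem_tsupport fun h => hy (hηω h)]

theorem nonneg_variation_of_isSelfCheeger (hω : IsOpen ω) (hφ : ContDiffOn ℝ 2 φ ω)
    (hφpos : ∀ y ∈ ω, 0 < φ y) (hself : IsSelfCheeger (halfCylinder ω) (subgraph ω φ))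
    (hη : ContDiff ℝ 1 η) (hs : HasCompactSupport η) (hηω : tsupport η ⊆ ω) (hη0 : 0 ≤ η)
    {ε : ℝ} (hε : 0 ≤ ε) (hεη : ∀ y ∈ ω, ε * η y < φ y) :
    0 ≤ ε * ((relPerimeter (halfCylinder ω) (subgraph ω φ)).toReal
            / (volume (subgraph ω φ)).toReal * (∫ y, η y)
          + ∫ y, inner ℝ (horizontalNormal φ y) (gradient η y))
        + ε ^ 2 * ∫ y, (areaElement φ y)⁻¹ * ‖gradient η y‖ ^ 2 / 2 := by
  have hφc : ContinuousOn φ ω := hφ.continuousOn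
  have hφ0 (y : Euc n) (hy : y ∈ ω) : 0 ≤ φ y := (hφpos y hy).le
  have harea := integrableOn_areaElement hω hφ hφpos
    (relPerimeter_subgraph_ne_top hω hφc hφpos hself)
  have hφint := integrableOn_of_volume_subgraph_ne_top hω hφc hφ0 hself.1.volume_ne_top
  set h := (relPerimeter (halfCylinder ω) (subgraph ω φ)).toReal / (volume (subgraph ω φ)).toReal
    with hdef
  have hquot : h * ∫ y in ω, φ y = ∫ y in ω, areaElement φ y := by
    rw [← toReal_volume_subgraph hω hφc hφ0, ← toReal_relPerimeter_subgraph hω hφ hφpos, hdef,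
      div_mul_cancel₀]
    exact (ENNReal.toReal_pos hself.1.volume_ne_zero hself.1.volume_ne_top).ne'
  obtain ⟨x, hx⟩ := nonempty_of_measure_ne_zero hself.1.volume_ne_zero
  have hcomp : IsCompetitor (subgraph ω φ) (subgraph ω fun y => φ y - ε * η y) :=
    isCompetitor_subgraph hω (hφc.sub (hη.continuous.const_mul ε).continuousOn)
      (fun y _ => sub_le_self _ (mul_nonneg hε (hη0 y)))
      ⟨_, hx.1.1, sub_pos.2 (hεη _ hx.1.1)⟩ hself.1.volume_ne_top
  obtain ⟨hfin, hper⟩ :=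
    toReal_relPerimeter_subgraph_sub_le hω (hφ.of_le one_le_two) harea hη hs hηω ε
  have hcheeger := hself.toReal_div_mul_volume_le hcomp hfin
  rw [toReal_volume_subgraph_sub hω hφc hφint hη.continuous hs hηω fun y hy => (hεη y hy).le,
    ← hdef] at hcheeger
  linarith

theorem nonneg_of_eventually_nonneg_mul_add_sq_mul {a b : ℝ}
    (h : ∀ᶠ ε in 𝓝[>] (0 : ℝ), 0 ≤ ε * a + ε ^ 2 * b) : 0 ≤ a := by
  have hlim : Tendsto (fun ε : ℝ => a + ε * b) (𝓝[>] 0) (𝓝 a) := by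
    have hcont : Continuous fun ε : ℝ => a + ε * b := by fun_prop
    simpa using (hcont.tendsto 0).mono_left nhdsWithin_le_nhds
  refine ge_of_tendsto hlim ?_
  filter_upwards [h, self_mem_nhdsWithin] with ε hε (hpos : 0 < ε)
  exact nonneg_of_mul_nonneg_right (by linarith) hpos

theorem neg_integral_inner_horizontalNormal_le (hω : IsOpen ω) (hφ : ContDiffOn ℝ 2 φ ω)
    (hφpos : ∀ y ∈ ω, 0 < φ y) (hself : IsSelfCheeger (halfCylinder ω) (subgraph ω φ))
    (hη : ContDiff ℝ 1 η) (hs : HasCompactSupport η) (hηω : tsupport η ⊆ ω) (hη0 : 0 ≤ η) :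
    -∫ y, inner ℝ (horizontalNormal φ y) (gradient η y)
      ≤ (relPerimeter (halfCylinder ω) (subgraph ω φ)).toReal / (volume (subgraph ω φ)).toReal
        * ∫ y, η y := by
  have hsmall := eventually_forall_mul_lt hη.continuous.continuousOn hs hηω hφ.continuousOn hφpos
  rw [neg_le_iff_add_nonneg]
  refine nonneg_of_eventually_nonneg_mul_add_sq_mul
    (b := ∫ y, (areaElement φ y)⁻¹ * ‖gradient η y‖ ^ 2 / 2) ?_
  filter_upwards [self_mem_nhdsWithin, hsmall.filter_mono nhdsWithin_le_nhds] with ε hε hεη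
  exact nonneg_variation_of_isSelfCheeger hω hφ hφpos hself hη hs hηω hη0 (le_of_lt hε) hεη

theorem divergence_horizontalNormal_le (hω : IsOpen ω) (hφ : ContDiffOn ℝ 2 φ ω)
    (hφpos : ∀ y ∈ ω, 0 < φ y) (hself : IsSelfCheeger (halfCylinder ω) (subgraph ω φ))
    {y : Euc n} (hy : y ∈ ω) :
    divergence (horizontalNormal φ) y
      ≤ (relPerimeter (halfCylinder ω) (subgraph ω φ)).toReal
        / (volume (subgraph ω φ)).toReal := by
  have hV : ContDiffOn ℝ 1 (horizontalNormal φ) ω :=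
    contDiffOn_horizontalNormal hω hφ (by norm_num)
  have hdiv := continuousOn_divergence hω hV
  rw [← sub_nonneg]
  refine nonneg_of_forall_integral_mul_nonneg (μ := volume) hω (continuousOn_const.sub hdiv) 1
    (fun η hη hs hηω hη0 => ?_) hy
  have hint : Integrable fun y => η y * divergence (horizontalNormal φ) y :=
    integrable_of_support_subset_isCompact hs (hη.continuous.continuousOn.mul (hdiv.mono hηω))
      ((support_mul_subset_left _ _).trans (subset_tsupport η))
  simp only [mul_sub, Pi.sub_apply]
  rw [integral_sub ((hη.continuous.integrable_of_hasCompactSupport hs).mul_const _) hint,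
    integral_mul_const, integral_mul_divergence hω hV hη hs hηω, sub_nonneg, mul_comm]
  exact neg_integral_inner_horizontalNormal_le hω hφ hφpos hself hη hs hηω hη0

end FirstVariation

end RelCheeger

theorem theorem3p7_general {n : ℕ} (hn : 1 ≤ n) {ω : Set (Euc n)} (hω : IsOpen ω)
    {φ : Euc n → ℝ} (hφ : ContDiffOn ℝ 2 φ ω) (hφpos : ∀ y ∈ ω, 0 < φ y)
    (hself : IsSelfCheeger (halfCylinder ω) (subgraph ω φ)) :
    relPerimeter (halfCylinder ω) (subgraph ω φ) ≠ ∞ ∧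
    ∀ x ∈ graph ω φ, meanCurvature (graphNormal ω φ) x ≤
      (relPerimeter (halfCylinder ω) (subgraph ω φ)).toReal /
        (n * (volume (subgraph ω φ)).toReal) := by
  refine ⟨relPerimeter_subgraph_ne_top hω hφ.continuousOn hφpos hself, fun x hx => ?_⟩
  have hn0 : (0 : ℝ) < n := by exact_mod_cast hn
  rw [meanCurvature_graphNormal hω hφ hx.1, mul_comm (n : ℝ), ← div_div,
    div_le_div_iff_of_pos_right hn0]
  exact divergence_horizontalNormal_le hω hφ hφpos hself hx.1

theorem theorem3p7 (n : ℕ) (hn : 1 ≤ n) (ω : Set (Euc n)) (hω : IsSmoothBoundedDomain ω)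
    (φ : Euc n → ℝ) (hφ : ContDiffOn ℝ 2 φ (closure ω)) (hφpos : ∀ y ∈ closure ω, 0 < φ y)
    (horth : MeetsOrthogonally ω φ)
    (hself : IsSelfCheeger (halfCylinder ω) (subgraph ω φ)) :
    relPerimeter (halfCylinder ω) (subgraph ω φ) ≠ ∞ ∧
    ∀ x ∈ graph ω φ, meanCurvature (graphNormal ω φ) x ≤
      (relPerimeter (halfCylinder ω) (subgraph ω φ)).toReal /
        (n * (volume (subgraph ω φ)).toReal) :=
  theorem3p7_general hn hω.isOpen (hφ.mono subset_closure)
    (fun y hy => hφpos y (subset_closure hy)) hself
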